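/- Let $\mathcal{E}$ be a complex Hilbert space and let $\Phi:\mathbb{D}\to\mathcal{B}(\mathcal{E})$ be a bounded analytic operator-valued function on the open unit disc with $\|\Phi\|_\infty=\sup_{\lambda\in\mathbb{D}}\|\Phi(\lambda)\|\le 1$. A bounded operator $T$ on a Hilbert space $\mathcal{H}$ is said to have a unitary part if there is a non-zero closed subspace $\mathcal{M}\subseteq\mathcal{H}$, invariant under $T$ and $T^*$, such that $T|_{\mathcal{M}}:\mathcal{M}\to\mathcal{M}$ is unitary. Let $H^2_{\mathcal{E}}(\mathbb{D})$ be the $\mathcal{E}$-valued Hardy space, identified through boundary values with the closed subspace of $L^2_{\mathcal{E}}(\mathbb{T})$ of functions whose Fourier coefficients of negative index vanish, and let $T_{\Phi(0)}=P_{H^2_{\mathcal{E}}(\mathbb{D})}L_{\Phi(0)}|_{H^2_{\mathcal{E}}(\mathbb{D})}$ be the Toeplitz operator on $H^2_{\mathcal{E}}(\mathbb{D})$ whose symbol is the constant function $\Phi(0)$, where $L_{\Phi(0)}$ is multiplication by $\Phi(0)$ on $L^2_{\mathcal{E}}(\mathbb{T})$. For Hilbert spaces $\mathcal{F},\mathcal{E}$,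 a bounded analytic function $\Theta:\mathbb{D}\to\mathcal{B}(\mathcal{F},\mathcal{E})$ is inner if its boundary value $\Theta(\zeta)$ (the radial limit in the strong operator topology) exists and is an isometry for almost every $\zeta\in\mathbb{T}$. Then the following are equivalent: (i) the operator $\Phi(0)$ on $\mathcal{E}$ has a unitary part; (ii) the constant Toeplitz operator $T_{\Phi(0)}$ on $H^2_{\mathcal{E}}(\mathbb{D})$ has a unitary part; (iii) there exist a non-zero Hilbert space $\mathcal{F}$, an inner function $\Theta\in H^\infty_{\mathcal{B}(\mathcal{F},\mathcal{E})}(\mathbb{D})$ and a unitary $U:\mathcal{F}\to\mathcal{F}$ such that $$\Phi(0)\Theta(\lambda)=\Theta(\lambda)U,\qquad \Phi(0)^*\Theta(\lambda)=\Theta(\lambda)U^*\qquad\text{for all }\lambda\in\mathbb{D};$$ (iv) there exist a non-zero Hilbert space $\mathcal{F}$, an inner function $\Theta\in H^\infty_{\mathcal{B}(\mathcal{F},\mathcal{E})}(\mathbb{D})$ and a unitary $U:\mathcal{F}\to\mathcal{F}$ such that $$\Phi(\lambda)\Theta(\lambda)=\Theta(\lambda)U,\qquad \Phi(\lambda)^*\Theta(\lambda)=\Theta(\lambda)U^*\qquad\text{for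 all }\lambda\in\mathbb{D}.$$ -/

import Mathlib

open MeasureTheory Filter Topology
open scoped ENNReal

universe u

noncomputable section

namespace ToeplitzHardy

/-- The unit circle, parametrised by `t ↦ e^{2πit}` (`AddCircle.toCircle`). -/
abbrev 𝕋 : Type := AddCircle (1 : ℝ)

/-- Normalized Lebesgue measure on the circle. -/
abbrev μT : Measure 𝕋 := AddCircle.haarAddCircle

section Operators

variable {H : Type*} [NormedAddCommGroup H] [InnerProductSpace ℂ H] [CompleteSpace H]

/-- `T` has a unitary part: there is a non-zero closed subspace `M`, invariant under `T` and `T*`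
(that is, reducing for `T`), such that the restriction `T|_M : M → M` is a unitary operator. -/
def HasUnitaryPart (T : H →L[ℂ] H) : Prop :=
  ∃ M : Submodule ℂ H, IsClosed (M : Set H) ∧ M ≠ ⊥ ∧
    (∀ x ∈ M, T x ∈ M) ∧ (∀ x ∈ M, ContinuousLinearMap.adjoint T x ∈ M) ∧
    ∃ U : M ≃ₗᵢ[ℂ] M, ∀ x : M, (U x : H) = T x

end Operators

section Spaces

variable (E : Type*) [NormedAddCommGroup E] [InnerProductSpace ℂ E] [CompleteSpace E]

/-- The Hilbert space `L²_E(𝕋)`. -/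
abbrev L2 : Type _ := Lp E 2 μT

lemma L2.integrable {G : Type*} [NormedAddCommGroup G] (f : Lp G 2 μT) : Integrable f μT :=
  (Lp.memLp f).integrable (by norm_num)

variable {E} in
lemma norm_fourierCoeff_le (f : L2 E) (n : ℤ) : ‖fourierCoeff f n‖ ≤ ‖f‖ := by
  have h1 : ‖fourierCoeff f n‖ ≤ ∫ t, ‖f t‖ ∂μT := by
    refine (norm_integral_le_integral_norm _).trans (le_of_eq ?_)
    refine integral_congr_ae (Eventually.of_forall fun t => ?_)
    simp [norm_smul, Circle.norm_coe]
  have h2 : ∫ t, ‖f t‖ ∂μT = (eLpNorm f 1 μT).toReal := by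
    rw [integral_norm_eq_lintegral_enorm (Lp.aestronglyMeasurable f), eLpNorm_one_eq_lintegral_enorm]
  have h3 : eLpNorm f 1 μT ≤ eLpNorm f 2 μT :=
    eLpNorm_le_eLpNorm_of_exponent_le (by norm_num) (Lp.aestronglyMeasurable f)
  rw [h2] at h1
  refine h1.trans ?_
  rw [Lp.norm_def]
  exact ENNReal.toReal_mono (Lp.eLpNorm_ne_top f) h3

/-- The `n`-th Fourier coefficient as a continuous linear map `L²_E(𝕋) → E`. -/
def fourierCoeffL (n : ℤ) : L2 E →L[ℂ] E :=
  LinearMap.mkContinuous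
    { toFun := fun f => fourierCoeff f n
      map_add' := fun f g => by
        rw [fourierCoeff_congr_ae (Lp.coeFn_add f g),
          fourierCoeff.add (L2.integrable f) (L2.integrable g)]
        rfl
      map_smul' := fun c f => by
        rw [fourierCoeff_congr_ae (Lp.coeFn_smul c f)]
        exact fourierCoeff.const_smul f c n }
    1 (fun f => by simpa using norm_fourierCoeff_le f n)

/-- The vector-valued Hardy space `H²_E`, identified as usual through boundary values with the
closed subspace of those `f ∈ L²_E(𝕋)` whose Fourier coefficients of negative index vanish, i.e.
of the `f = ∑_{n ≥ 0} aₙ zⁿ` with `aₙ ∈ E` and `∑ ‖aₙ‖² < ∞`. -/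
def H2 : Submodule ℂ (L2 E) where
  carrier := {f | ∀ n : ℤ, n < 0 → fourierCoeff f n = 0}
  zero_mem' := fun n _ => map_zero (fourierCoeffL E n)
  add_mem' := fun {f g} hf hg n hn => by
    have h := map_add (fourierCoeffL E n) f g
    change fourierCoeff (f + g : L2 E) n = fourierCoeff f n + fourierCoeff g n at h
    rw [h, hf n hn, hg n hn, add_zero]
  smul_mem' := fun c f hf n hn => by
    have h := map_smul (fourierCoeffL E n) c f
    change fourierCoeff (c • f : L2 E) n = c • fourierCoeff f n at h
    rw [h, hf n hn, smul_zero]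

lemma isClosed_H2 : IsClosed (H2 E : Set (L2 E)) := by
  have h : (H2 E : Set (L2 E)) = ⋂ (n : ℤ) (_ : n < 0), (fourierCoeffL E n) ⁻¹' {0} := by
    ext f
    simp only [Set.mem_iInter, Set.mem_preimage, Set.mem_singleton_iff]
    rfl
  rw [h]
  exact isClosed_iInter fun n => isClosed_iInter fun _ =>
    isClosed_singleton.preimage (fourierCoeffL E n).continuous

instance : CompleteSpace (H2 E) := (isClosed_H2 E).completeSpace_coe

end Spaces

section Toeplitz

variable {E : Type*} [NormedAddCommGroup E] [InnerProductSpace ℂ E] [CompleteSpace E]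

/-- The Laurent operator `L_Φ f = Φ f` on `L²_E(𝕋)` with symbol `Φ ∈ L^∞_{B(E)}(𝕋)`. -/
def laurent (Φ : Lp (E →L[ℂ] E) ∞ μT) : L2 E →L[ℂ] L2 E :=
  (ContinuousLinearMap.id ℂ (E →L[ℂ] E)).holderL μT ∞ 2 2 Φ

/-- The Toeplitz operator `T_Φ = P_{H²} L_Φ |_{H²}`. -/
def toeplitz (Φ : Lp (E →L[ℂ] E) ∞ μT) : H2 E →L[ℂ] H2 E :=
  (H2 E).orthogonalProjectionOnto ∘L laurent Φ ∘L (H2 E).subtypeL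

/-- The Toeplitz operator `T_A` on `H²_E` with constant symbol `A ∈ B(E)`. -/
def constToeplitz (A : E →L[ℂ] E) : H2 E →L[ℂ] H2 E :=
  toeplitz (Lp.const ∞ μT A)

end Toeplitz

section Analytic

variable {F E : Type*} [NormedAddCommGroup F] [InnerProductSpace ℂ F]
  [NormedAddCommGroup E] [InnerProductSpace ℂ E]

/-- `Φ ∈ H^∞_{B(F,E)}(𝔻)`: a bounded analytic operator-valued function on the open unit disc
(only the values on the disc matter). -/
def MemHInfty (Φ : ℂ → F →L[ℂ] E) : Prop :=
  DifferentiableOn ℂ Φ (Metric.ball 0 1) ∧ ∃ C : ℝ, ∀ z ∈ Metric.ball (0 : ℂ) 1, ‖Φ z‖ ≤ C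

/-- `Φ` is inner: a function of class `H^∞` whose boundary value at almost every point `ζ` of the
circle (the radial limit in the strong operator topology) exists and is an isometry. -/
def IsInner (Φ : ℂ → F →L[ℂ] E) : Prop :=
  MemHInfty Φ ∧ ∀ᵐ t ∂μT, ∃ V : F →ₗᵢ[ℂ] E, ∀ x : F,
    Tendsto (fun r : ℝ => Φ (r * (AddCircle.toCircle t : ℂ)) x) (𝓝[<] 1) (𝓝 (V x))

end Analytic

end ToeplitzHardy

end

/-! A unitary part amounts to a non-zero subspace, invariant under `T` and `T*`, on which `T*T` and
`TT*` are the identity. These identities pass to closures and are carried along by any linear map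
intertwining both operators and their adjoints. The constant Toeplitz operator applies `A` to each
Fourier coefficient, so the constants and the coefficient maps carry a unitary part between `A` and
`T_A`. A unitary part of `Φ 0` on `M` yields (iii) with `Θ` the constant inclusion of `M`. To move
between (iii), (iv) and (i), freeze the operator `Θ l`: the two relations at one point `w` make `Φ
w` isometric on its range, so by the maximum modulus principle `Φ z` agrees with `Φ w` there for
every `z`, and contractivity recovers the adjoint relation (`intertwines_of_intertwines`). -/

namespace ToeplitzHardy

/-! ### Unitary parts through `T*T = TT* = 1` -/

section UnitaryPart

variable {H : Type*} [NormedAddCommGroup H] [InnerProductSpace ℂ H] [CompleteSpace H]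

open ContinuousLinearMap (adjoint)

/-- A contraction satisfies `T* T x = x` at every vector `x` whose norm it preserves. -/
lemma adjoint_apply_apply_of_norm_eq {T : H →L[ℂ] H} (hT : ‖T‖ ≤ 1) {x : H}
    (hx : ‖T x‖ = ‖x‖) : adjoint T (T x) = x := by
  have h1 : ‖adjoint T (T x)‖ ≤ ‖x‖ := by
    have h := (adjoint T).le_of_opNorm_le (c := 1) (by simpa using hT) (T x)
    rwa [one_mul, hx] at h
  have h2 : RCLike.re (inner ℂ (adjoint T (T x)) x) = ‖x‖ ^ 2 := by
    rw [ContinuousLinearMap.adjoint_inner_left, inner_self_eq_norm_sq, hx]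
  have h3 := norm_sub_sq (𝕜 := ℂ) (adjoint T (T x)) x
  rw [h2] at h3
  -- The expansion is `‖T*Tx‖² - 2‖x‖² + ‖x‖²`, with `‖T*Tx‖ ≤ ‖x‖`.
  have h4 : ‖adjoint T (T x) - x‖ ^ 2 ≤ 0 := by
    nlinarith [norm_nonneg (adjoint T (T x)), norm_nonneg x]
  have h5 : ‖adjoint T (T x) - x‖ = 0 := by
    nlinarith [norm_nonneg (adjoint T (T x) - x)]
  exact sub_eq_zero.mp (norm_eq_zero.mp h5)

lemma norm_apply_of_adjoint_apply_apply {T : H →L[ℂ] H} {x : H}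
    (hx : adjoint T (T x) = x) : ‖T x‖ = ‖x‖ := by
  have h : ‖T x‖ ^ 2 = ‖x‖ ^ 2 := by
    rw [← inner_self_eq_norm_sq (𝕜 := ℂ) (T x), ← ContinuousLinearMap.adjoint_inner_left, hx,
      inner_self_eq_norm_sq]
  exact (sq_eq_sq₀ (norm_nonneg _) (norm_nonneg _)).mp h

/-- On a subspace witnessing a unitary part, both `T* T` and `T T*` are the identity. -/
lemma adjoint_comp_self_of_unitary_restriction {T : H →L[ℂ] H} {M : Submodule ℂ H}
    (hT : ∀ x ∈ M, T x ∈ M) (hT' : ∀ x ∈ M, adjoint T x ∈ M)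
    (U : M ≃ₗᵢ[ℂ] M) (hU : ∀ x : M, (U x : H) = T x) :
    (∀ x ∈ M, adjoint T (T x) = x) ∧ ∀ x ∈ M, T (adjoint T x) = x := by
  have key : ∀ x ∈ M, adjoint T (T x) = x := by
    intro x hx
    -- This difference lies in `M` and is orthogonal to `M`.
    have hmem : adjoint T (T x) - x ∈ M := M.sub_mem (hT' _ (hT x hx)) hx
    have horth : ∀ y ∈ M, inner ℂ (adjoint T (T x) - x) y = 0 := by
      intro y hy
      have h := U.inner_map_map ⟨x, hx⟩ ⟨y, hy⟩
      rw [Submodule.coe_inner, Submodule.coe_inner, hU, hU] at h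
      rw [inner_sub_left, ContinuousLinearMap.adjoint_inner_left, h, sub_self]
    exact sub_eq_zero.mp (inner_self_eq_zero.mp (horth _ hmem))
  refine ⟨key, fun x hx => ?_⟩
  have h : T (U.symm ⟨x, hx⟩ : M) = x := by rw [← hU, U.apply_symm_apply]
  rw [← h, key _ (U.symm ⟨x, hx⟩).2]

/-- An operator has a unitary part as soon as `T* T` and `T T*` are the identity on some non-zero,
not necessarily closed, subspace invariant under `T` and `T*`. -/
lemma HasUnitaryPart.of_submodule {T : H →L[ℂ] H} (N : Submodule ℂ H) (hN : N ≠ ⊥)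
    (hT : ∀ x ∈ N, T x ∈ N) (hT' : ∀ x ∈ N, adjoint T x ∈ N)
    (h1 : ∀ x ∈ N, adjoint T (T x) = x) (h2 : ∀ x ∈ N, T (adjoint T x) = x) :
    HasUnitaryPart T := by
  have inv : ∀ S : H →L[ℂ] H, (∀ x ∈ N, S x ∈ N) →
      ∀ x ∈ N.topologicalClosure, S x ∈ N.topologicalClosure := fun S hS x hx =>
    map_mem_closure S.continuous hx hS
  have fix : ∀ S : H →L[ℂ] H, (∀ x ∈ N, S x = x) → ∀ x ∈ N.topologicalClosure, S x = x := by
    intro S hS x hx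
    have hc : IsClosed {x | S x = x} := isClosed_eq S.continuous continuous_id
    exact closure_minimal (s := (N : Set H)) hS hc hx
  have g1 := fix (adjoint T ∘L T) h1
  have g2 := fix (T ∘L adjoint T) h2
  have i1 := inv T hT
  have i2 := inv (adjoint T) hT'
  refine ⟨N.topologicalClosure, N.isClosed_topologicalClosure, ?_, i1, i2, ?_⟩
  · intro h
    exact hN (le_bot_iff.mp (h ▸ N.le_topologicalClosure))
  · exact ⟨
      { toLinearEquiv := LinearEquiv.ofLinearMap ((T : H →ₗ[ℂ] H).restrict i1)
          ((adjoint T : H →ₗ[ℂ] H).restrict i2)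
          (by ext x; exact g2 x x.2) (by ext x; exact g1 x x.2)
        norm_map' := fun x => norm_apply_of_adjoint_apply_apply (g1 x x.2) }, fun x => rfl⟩

end UnitaryPart

/-! ### Fourier coefficients of vector-valued functions -/

section Fourier

variable {E G : Type*} [NormedAddCommGroup E] [InnerProductSpace ℂ E] [CompleteSpace E]
  [NormedAddCommGroup G] [InnerProductSpace ℂ G] [CompleteSpace G]

lemma fourierCoeff_compLp (L : E →L[ℂ] G) (f : L2 E) (n : ℤ) :
    fourierCoeff (L.compLp f) n = L (fourierCoeff f n) := by
  have hint : Integrable (fun t : 𝕋 => fourier (-n) t • f t) μT := by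
    refine (integrable_norm_iff ?_).mp ?_
    · exact ((fourier (-n)).continuous.aestronglyMeasurable).smul (L2.integrable f).1
    · simpa [norm_smul, Circle.norm_coe] using (L2.integrable f).norm
  rw [fourierCoeff_congr_ae (L.coeFn_compLp f)]
  unfold fourierCoeff
  rw [← L.integral_comp_comm hint]
  simp

lemma eq_zero_of_fourierCoeff_eq_zero_scalar (f : L2 ℂ) (hf : ∀ n, fourierCoeff f n = 0) :
    f = 0 := by
  have h : fourierBasis.repr f = 0 := by
    ext i
    rw [fourierBasis_repr, hf i]
    rfl
  simpa using h

/-- A function in `L²_E` is determined by its Fourier coefficients. -/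
lemma eq_zero_of_fourierCoeff_eq_zero (f : L2 E) (hf : ∀ n, fourierCoeff f n = 0) : f = 0 := by
  rw [Lp.eq_zero_iff_ae_eq_zero]
  refine (L2.integrable f).ae_eq_zero_of_forall_setIntegral_eq_zero fun s _ _ => ?_
  -- Pairing with a fixed `y` reduces to the scalar case; the null set may depend on `y`, which is
  -- harmless for integrals.
  refine ext_inner_left ℂ fun y => ?_
  have h0 : (innerSL ℂ y).compLp f = 0 :=
    eq_zero_of_fourierCoeff_eq_zero_scalar _ fun n => by
      rw [fourierCoeff_compLp, hf, map_zero]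
  have hae : ∀ᵐ t ∂μT, inner ℂ y (f t) = 0 := by
    filter_upwards [(innerSL ℂ y).coeFn_compLp f, Lp.eq_zero_iff_ae_eq_zero.mp h0] with t h1 h2
    rw [h2] at h1
    exact h1.symm
  rw [inner_zero_right, ← integral_inner (L2.integrable f).integrableOn]
  exact integral_eq_zero_of_ae (ae_restrict_of_ae hae)

end Fourier

/-! ### Toeplitz operators with constant symbol -/

section ConstToeplitz

variable {E : Type*} [NormedAddCommGroup E] [InnerProductSpace ℂ E] [CompleteSpace E]

open ContinuousLinearMap (adjoint)

lemma laurent_const (A : E →L[ℂ] E) (f : L2 E) :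
    laurent (Lp.const ∞ μT A) f = A.compLp f := by
  apply Lp.ext
  have h := (ContinuousLinearMap.id ℂ (E →L[ℂ] E)).coeFn_holder (r := 2) (Lp.const ∞ μT A) f
  filter_upwards [h, Lp.coeFn_const (p := ∞) (μ := μT) A, A.coeFn_compLp f] with t h1 h2 h3
  rw [h3]
  refine h1.trans ?_
  rw [h2]
  rfl

/-- This makes the projection in the definition of `T_A` act trivially. -/
lemma compLp_mem_H2 (A : E →L[ℂ] E) {f : L2 E} (hf : f ∈ H2 E) : A.compLp f ∈ H2 E := by
  intro n hn
  rw [fourierCoeff_compLp, hf n hn, map_zero]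

lemma coe_constToeplitz_apply (A : E →L[ℂ] E) (f : H2 E) :
    (constToeplitz A f : L2 E) = A.compLp (f : L2 E) := by
  have h : constToeplitz A f
      = (H2 E).orthogonalProjectionOnto (laurent (Lp.const ∞ μT A) (f : L2 E)) := rfl
  rw [h, laurent_const]
  exact congrArg Subtype.val
    ((H2 E).orthogonalProjectionOnto_mem_subspace_eq_self ⟨_, compLp_mem_H2 A f.2⟩)

lemma inner_compLp_left (A : E →L[ℂ] E) (f g : L2 E) :
    inner ℂ (A.compLp f) g = inner ℂ f ((adjoint A).compLp g) := by
  rw [MeasureTheory.L2.inner_def, MeasureTheory.L2.inner_def]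
  refine integral_congr_ae ?_
  filter_upwards [A.coeFn_compLp f, (adjoint A).coeFn_compLp g] with t h1 h2
  rw [h1, h2, ContinuousLinearMap.adjoint_inner_right]

lemma adjoint_constToeplitz (A : E →L[ℂ] E) :
    adjoint (constToeplitz A) = constToeplitz (adjoint A) := by
  symm
  rw [ContinuousLinearMap.eq_adjoint_iff]
  intro f g
  rw [Submodule.coe_inner, Submodule.coe_inner, coe_constToeplitz_apply, coe_constToeplitz_apply,
    inner_compLp_left, ContinuousLinearMap.adjoint_adjoint]

/-- The constant functions, as a linear map from `E` into `H²_E`. -/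
noncomputable def constH2 : E →ₗ[ℂ] H2 E where
  toFun x := ⟨Lp.const 2 μT x, fun n hn => by
    rw [fourierCoeff_congr_ae (Lp.coeFn_const (p := 2) (μ := μT) x)]
    have h : fourierCoeff (T := 1) (fun _ => (1 : ℂ)) n = 0 := by
      have h0 : (fun _ : 𝕋 => (1 : ℂ)) = fourier 0 := by ext; simp
      rw [h0, fourierCoeff_fourier, Pi.single_eq_of_ne hn.ne]
    unfold fourierCoeff at h ⊢
    simp only [smul_eq_mul, mul_one] at h
    change ∫ t : 𝕋, fourier (-n) t • x ∂μT = 0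
    rw [integral_smul_const, h, zero_smul]⟩
  map_add' x y := rfl
  map_smul' c x := rfl

lemma constH2_injective : Function.Injective (constH2 (E := E)) := by
  rw [injective_iff_map_eq_zero]
  intro x hx
  have h : Lp.const 2 μT x = 0 := congrArg Subtype.val hx
  have h1 := (Lp.coeFn_const (p := 2) (μ := μT) x).symm.trans (Lp.eq_zero_iff_ae_eq_zero.mp h)
  obtain ⟨t, ht⟩ := h1.exists
  exact ht

lemma constToeplitz_constH2 (A : E →L[ℂ] E) (x : E) :
    constToeplitz A (constH2 x) = constH2 (A x) := by
  apply Subtype.ext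
  rw [coe_constToeplitz_apply]
  apply Lp.ext
  filter_upwards [A.coeFn_compLp (constH2 x : L2 E), Lp.coeFn_const (p := 2) (μ := μT) x,
    Lp.coeFn_const (p := 2) (μ := μT) (A x)] with t h1 h2 h3
  rw [h1]
  exact (congrArg A h2).trans h3.symm

lemma HasUnitaryPart.constToeplitz {A : E →L[ℂ] E} (hA : HasUnitaryPart A) :
    HasUnitaryPart (constToeplitz A) := by
  obtain ⟨M, -, hM, hT, hT', U, hU⟩ := hA
  obtain ⟨h1, h2⟩ := adjoint_comp_self_of_unitary_restriction hT hT' U hU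
  refine HasUnitaryPart.of_submodule (M.map constH2) ?_ ?_ ?_ ?_ ?_
  · obtain ⟨x, hx, hx0⟩ := M.ne_bot_iff.mp hM
    exact (Submodule.ne_bot_iff _).mpr
      ⟨_, ⟨x, hx, rfl⟩, (map_ne_zero_iff _ constH2_injective).mpr hx0⟩
  all_goals
    rintro _ ⟨x, hx, rfl⟩
    simp only [adjoint_constToeplitz, constToeplitz_constH2]
  · exact ⟨_, hT x hx, rfl⟩
  · exact ⟨_, hT' x hx, rfl⟩
  · rw [h1 x hx]
  · rw [h2 x hx]

lemma fourierCoeff_constToeplitz (A : E →L[ℂ] E) (f : H2 E) (n : ℤ) :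
    fourierCoeff (constToeplitz A f : L2 E) n = A (fourierCoeff (f : L2 E) n) := by
  rw [coe_constToeplitz_apply, fourierCoeff_compLp]

/-- Some coefficient map is non-zero on `M` and intertwines `T_A` with `A`, and their adjoints. The
image of `M` need not be closed, which `of_submodule` allows. -/
lemma HasUnitaryPart.of_constToeplitz {A : E →L[ℂ] E}
    (hA : HasUnitaryPart (ToeplitzHardy.constToeplitz A)) : HasUnitaryPart A := by
  obtain ⟨M, -, hM, hT, hT', U, hU⟩ := hA
  obtain ⟨h1, h2⟩ := adjoint_comp_self_of_unitary_restriction hT hT' U hU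
  rw [adjoint_constToeplitz] at hT' h1 h2
  obtain ⟨f, hf, hf0⟩ := M.ne_bot_iff.mp hM
  obtain ⟨n, hn⟩ : ∃ n, fourierCoeff (f : L2 E) n ≠ 0 := by
    by_contra! h
    exact hf0 (Subtype.ext (eq_zero_of_fourierCoeff_eq_zero _ h))
  have coe : ∀ g : H2 E, ((fourierCoeffL E n ∘L (H2 E).subtypeL : H2 E →L[ℂ] E) :
      H2 E →ₗ[ℂ] E) g = fourierCoeff (g : L2 E) n := fun _ => rfl
  refine HasUnitaryPart.of_submodule
    (M.map ((fourierCoeffL E n ∘L (H2 E).subtypeL : H2 E →L[ℂ] E) : H2 E →ₗ[ℂ] E)) ?_ ?_ ?_ ?_ ?_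
  · exact (Submodule.ne_bot_iff _).mpr ⟨_, ⟨f, hf, rfl⟩, hn⟩
  all_goals
    rintro _ ⟨g, hg, rfl⟩
    simp only [coe, ← fourierCoeff_constToeplitz]
  · exact ⟨_, hT g hg, rfl⟩
  · exact ⟨_, hT' g hg, rfl⟩
  · rw [h1 g hg]
  · rw [h2 g hg]

end ConstToeplitz

/-! ### Maximum modulus and intertwining -/

section Contractive

variable {E F : Type*} [NormedAddCommGroup E] [InnerProductSpace ℂ E]
  [NormedAddCommGroup F] [InnerProductSpace ℂ F]

open ContinuousLinearMap (adjoint)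

/-- Maximum modulus: where a contractive analytic function attains the norm of `x` at one point of
the disc, `Φ z x` does not depend on `z`. -/
lemma apply_eq_of_norm_apply_eq {Φ : ℂ → E →L[ℂ] E}
    (hΦ : DifferentiableOn ℂ Φ (Metric.ball 0 1)) (hΦ1 : ∀ z ∈ Metric.ball (0 : ℂ) 1, ‖Φ z‖ ≤ 1)
    {x : E} {w z : ℂ} (hw : w ∈ Metric.ball (0 : ℂ) 1) (hz : z ∈ Metric.ball (0 : ℂ) 1)
    (hx : ‖Φ w x‖ = ‖x‖) : Φ z x = Φ w x := by
  -- The real structure makes `E` strictly convex, so that a maximum of the norm forces the vector,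
  -- not just its norm, to be constant.
  let _ : InnerProductSpace ℝ E := InnerProductSpace.complexToReal
  refine Complex.eqOn_of_isPreconnected_of_isMaxOn_norm (f := fun z => Φ z x) (c := w)
    (convex_ball (0 : ℂ) 1).isPreconnected Metric.isOpen_ball
    (hΦ.clm_apply (differentiableOn_const x)) hw (fun v hv => ?_) hz
  have h := (Φ v).le_of_opNorm_le (hΦ1 v hv) x
  rw [one_mul] at h
  change ‖Φ v x‖ ≤ ‖Φ w x‖
  rwa [hx]

/-- Otherwise the radial limits vanish and cannot be isometries on `F ≠ 0`. -/
lemma IsInner.exists_apply_ne_zero [Nontrivial F] {Θ : ℂ → F →L[ℂ] E} (hΘ : IsInner Θ) :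
    ∃ l ∈ Metric.ball (0 : ℂ) 1, ∃ y, Θ l y ≠ 0 := by
  by_contra! h
  obtain ⟨t, V, hV⟩ := hΘ.2.exists
  obtain ⟨y, hy⟩ := exists_ne (0 : F)
  refine hy (norm_eq_zero.mp ?_)
  rw [← V.norm_map, norm_eq_zero]
  refine tendsto_nhds_unique (hV y) (tendsto_const_nhds.congr' ?_)
  filter_upwards [Ioo_mem_nhdsLT (show (0 : ℝ) < 1 by norm_num)] with r hr
  refine (h _ ?_ y).symm
  simpa [abs_of_pos hr.1, Circle.norm_coe] using hr.2

lemma isInner_const (V : F →ₗᵢ[ℂ] E) : IsInner fun _ : ℂ => V.toContinuousLinearMap :=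
  ⟨⟨differentiableOn_const _, ‖V.toContinuousLinearMap‖, fun _ _ => le_rfl⟩,
    Eventually.of_forall fun _ => ⟨V, fun _ => tendsto_const_nhds⟩⟩

variable [CompleteSpace E] [CompleteSpace F]

/-- If a contractive analytic function intertwines at one point of the disc an operator `Θ` with a
unitary, then it does so at every point. -/
lemma intertwines_of_intertwines {Φ : ℂ → E →L[ℂ] E}
    (hΦ : DifferentiableOn ℂ Φ (Metric.ball 0 1)) (hΦ1 : ∀ z ∈ Metric.ball (0 : ℂ) 1, ‖Φ z‖ ≤ 1)
    {w z : ℂ} (hw : w ∈ Metric.ball (0 : ℂ) 1) (hz : z ∈ Metric.ball (0 : ℂ) 1)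
    {Θ : F →L[ℂ] E} {U : F →L[ℂ] F} (hU : U ∈ unitary (F →L[ℂ] F))
    (h1 : Φ w ∘L Θ = Θ ∘L U) (h2 : adjoint (Φ w) ∘L Θ = Θ ∘L adjoint U) :
    Φ z ∘L Θ = Θ ∘L U ∧ adjoint (Φ z) ∘L Θ = Θ ∘L adjoint U := by
  have hUl : ∀ y, adjoint U (U y) = y := fun y => DFunLike.congr_fun hU.1 y
  have hUr : ∀ y, U (adjoint U y) = y := fun y => DFunLike.congr_fun hU.2 y
  have e1 : ∀ y, Φ w (Θ y) = Θ (U y) := fun y => DFunLike.congr_fun h1 y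
  have e2 : ∀ y, adjoint (Φ w) (Θ y) = Θ (adjoint U y) := fun y => DFunLike.congr_fun h2 y
  have hnorm : ∀ y, ‖Φ w (Θ y)‖ = ‖Θ y‖ := fun y =>
    norm_apply_of_adjoint_apply_apply (by rw [e1, e2, hUl])
  have e3 : ∀ y, Φ z (Θ y) = Θ (U y) := fun y => by
    rw [apply_eq_of_norm_apply_eq hΦ hΦ1 hw hz (hnorm y), e1]
  refine ⟨ContinuousLinearMap.ext e3, ContinuousLinearMap.ext fun y => ?_⟩
  -- `Φ z` maps `Θ U* y` to `Θ y` without changing the norm, so its adjoint maps `Θ y` back.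
  have hn : ‖Φ z (Θ (adjoint U y))‖ = ‖Θ (adjoint U y)‖ := by
    rw [← hnorm, e3, e1]
  have h := adjoint_apply_apply_of_norm_eq (hΦ1 z hz) hn
  rw [e3, hUr] at h
  exact h

/-- The range of `Θ` carries the unitary part, since `A` and `A*` act on it as `U` and `U*`. -/
lemma HasUnitaryPart.of_intertwines {A : E →L[ℂ] E} {Θ : F →L[ℂ] E} {U : F →L[ℂ] F}
    (hU : U ∈ unitary (F →L[ℂ] F)) (hΘ : ∃ y, Θ y ≠ 0)
    (h1 : A ∘L Θ = Θ ∘L U) (h2 : adjoint A ∘L Θ = Θ ∘L adjoint U) : HasUnitaryPart A := by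
  have hUl : ∀ y, adjoint U (U y) = y := fun y => DFunLike.congr_fun hU.1 y
  have hUr : ∀ y, U (adjoint U y) = y := fun y => DFunLike.congr_fun hU.2 y
  have e1 : ∀ y, A (Θ y) = Θ (U y) := fun y => DFunLike.congr_fun h1 y
  have e2 : ∀ y, adjoint A (Θ y) = Θ (adjoint U y) := fun y => DFunLike.congr_fun h2 y
  obtain ⟨y, hy⟩ := hΘ
  refine HasUnitaryPart.of_submodule (LinearMap.range (Θ : F →ₗ[ℂ] E)) ?_ ?_ ?_ ?_ ?_
  · exact (Submodule.ne_bot_iff _).mpr ⟨_, ⟨y, rfl⟩, hy⟩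
  all_goals
    rintro _ ⟨x, rfl⟩
    simp only [ContinuousLinearMap.coe_coe, e1, e2, hUl, hUr]
  · exact ⟨_, rfl⟩
  · exact ⟨_, rfl⟩

end Contractive

/-- The unitary part of `A` is intertwined with a unitary by a constant inner function. -/
lemma HasUnitaryPart.exists_isInner {E : Type u} [NormedAddCommGroup E] [InnerProductSpace ℂ E]
    [CompleteSpace E] {A : E →L[ℂ] E} (hA : HasUnitaryPart A) :
    ∃ (F : Type u) (_ : NormedAddCommGroup F) (_ : InnerProductSpace ℂ F) (_ : CompleteSpace F)
      (_ : Nontrivial F) (Θ : ℂ → F →L[ℂ] E) (U : F →L[ℂ] F),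
      IsInner Θ ∧ U ∈ unitary (F →L[ℂ] F) ∧
      ∀ l ∈ Metric.ball (0 : ℂ) 1,
        A ∘L Θ l = Θ l ∘L U ∧
        ContinuousLinearMap.adjoint A ∘L Θ l = Θ l ∘L ContinuousLinearMap.adjoint U := by
  obtain ⟨M, hc, hM, hT, hT', U, hU⟩ := hA
  have hcM : CompleteSpace M := hc.completeSpace_coe
  have hnM : Nontrivial M := Submodule.nontrivial_iff_ne_bot.mpr hM
  obtain ⟨h1, -⟩ := adjoint_comp_self_of_unitary_restriction hT hT' U hU
  refine ⟨M, inferInstance, inferInstance, hcM, hnM, _, (Unitary.linearIsometryEquiv.symm U).1,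
    isInner_const M.subtypeₗᵢ, (Unitary.linearIsometryEquiv.symm U).2, fun l _ => ⟨?_, ?_⟩⟩
  · ext x
    exact (hU x).symm
  · have hadj : ContinuousLinearMap.adjoint ((Unitary.linearIsometryEquiv.symm U).1)
        = (U.symm.toContinuousLinearEquiv : M →L[ℂ] M) :=
      U.adjoint_eq_symm
    rw [hadj]
    -- `A* x = A* A U⁻¹ x = U⁻¹ x` on `M`.
    ext x
    change ContinuousLinearMap.adjoint A x = (U.symm x : M)
    have h := h1 _ (U.symm x).2
    rwa [← hU, U.apply_symm_apply] at h

end ToeplitzHardy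

theorem proposition4p3 {E : Type u} [NormedAddCommGroup E] [InnerProductSpace ℂ E]
    [CompleteSpace E] (Φ : ℂ → E →L[ℂ] E) (hΦ : ToeplitzHardy.MemHInfty Φ)
    (hΦ1 : ∀ z ∈ Metric.ball (0 : ℂ) 1, ‖Φ z‖ ≤ 1) :
    List.TFAE [
      ToeplitzHardy.HasUnitaryPart (Φ 0),
      ToeplitzHardy.HasUnitaryPart (ToeplitzHardy.constToeplitz (Φ 0)),
      ∃ (F : Type u) (_ : NormedAddCommGroup F) (_ : InnerProductSpace ℂ F) (_ : CompleteSpace F)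
        (_ : Nontrivial F) (Θ : ℂ → F →L[ℂ] E) (U : F →L[ℂ] F),
        ToeplitzHardy.IsInner Θ ∧ U ∈ unitary (F →L[ℂ] F) ∧
        ∀ l ∈ Metric.ball (0 : ℂ) 1,
          Φ 0 ∘L Θ l = Θ l ∘L U ∧
          ContinuousLinearMap.adjoint (Φ 0) ∘L Θ l = Θ l ∘L ContinuousLinearMap.adjoint U,
      ∃ (F : Type u) (_ : NormedAddCommGroup F) (_ : InnerProductSpace ℂ F) (_ : CompleteSpace F)
        (_ : Nontrivial F) (Θ : ℂ → F →L[ℂ] E) (U : F →L[ℂ] F),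
        ToeplitzHardy.IsInner Θ ∧ U ∈ unitary (F →L[ℂ] F) ∧
        ∀ l ∈ Metric.ball (0 : ℂ) 1,
          Φ l ∘L Θ l = Θ l ∘L U ∧
          ContinuousLinearMap.adjoint (Φ l) ∘L Θ l = Θ l ∘L ContinuousLinearMap.adjoint U] := by
  have h0 : (0 : ℂ) ∈ Metric.ball (0 : ℂ) 1 := Metric.mem_ball_self one_pos
  tfae_have 1 → 2 := fun h => h.constToeplitz
  tfae_have 2 → 1 := fun h => h.of_constToeplitz
  tfae_have 1 → 3 := fun h => h.exists_isInner
  tfae_have 3 → 4 := by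
    rintro ⟨F, i1, i2, i3, i4, Θ, U, hΘ, hU, h⟩
    exact ⟨F, i1, i2, i3, i4, Θ, U, hΘ, hU, fun l hl =>
      ToeplitzHardy.intertwines_of_intertwines hΦ.1 hΦ1 h0 hl hU (h l hl).1 (h l hl).2⟩
  tfae_have 4 → 1 := by
    rintro ⟨F, i1, i2, i3, i4, Θ, U, hΘ, hU, h⟩
    -- `Θ 0` may vanish, so the relation for the fixed operator `Θ l ≠ 0` is transported from `Φ l`
    -- to `Φ 0`.
    obtain ⟨l, hl, hy⟩ := hΘ.exists_apply_ne_zero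
    obtain ⟨e1, e2⟩ :=
      ToeplitzHardy.intertwines_of_intertwines hΦ.1 hΦ1 hl h0 hU (h l hl).1 (h l hl).2
    exact ToeplitzHardy.HasUnitaryPart.of_intertwines hU hy e1 e2
  tfae_finish
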